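/- For a finite simple graph $G=(V,E)$ and $S\subseteq V$ let $\delta_G(S)\in\{0,1\}^E$ be the vector whose $uv$-coordinate is $1$ if exactly one of $u,v$ lies in $S$ and $0$ otherwise, and let $\mathrm{CUT}(G)=\operatorname{conv}\{\delta_G(S): S\subseteq V\}\subseteq\mathbb{R}^E$ be the cut polytope of $G$. The extension complexity $\mathrm{xc}(P)$ of a polytope $P$ is the minimum number of facets of a polytope $Q\subseteq\mathbb{R}^e$ ($e$ arbitrary) such that $P$ is the image of $Q$ under a linear map. A graph $H$ is a minor of $G$ if, up to relabeling, it can be obtained from $G$ by contracting edges and deleting edges and isolated vertices. (1) There are constants $c>0$ and $n_0\in\mathbb{N}$ such that for every $n\ge n_0$ and every finite simple graph $G$ that has the complete graph $K_n$ as a minor, $\mathrm{xc}(\mathrm{CUT}(G))\ge 2^{cn}$. (2) There are constants $c>0$ and $n_0\in\mathbb{N}$ such that for every $n\ge n_0$ the complete tripartite graph $K_{1,n,n}$ satisfies $\mathrm{xc}(\mathrm{CUT}(K_{1,n,n}))\ge 2^{cn}$. -/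

import Mathlib

namespace CutExtension

/-- A polytope: the convex hull of a finite set of points. -/
def IsPolytope {E : Type*} [AddCommGroup E] [Module ℝ E] (Q : Set E) : Prop :=
  ∃ s : Set E, s.Finite ∧ Q = convexHull ℝ s

/-- The dimension of (the affine hull of) a nonempty set. -/
noncomputable def dim {E : Type*} [AddCommGroup E] [Module ℝ E] (Q : Set E) : ℕ :=
  Module.finrank ℝ (vectorSpan ℝ Q)

/-- `F` is a facet of the polytope `Q`: a nonempty face of dimension `dim Q - 1`. The nonempty
faces of a polytope are the sets of maximizers over it of linear functionals, which are Mathlib's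
exposed subsets. -/
def IsFacet {E : Type*} [AddCommGroup E] [Module ℝ E] [TopologicalSpace E]
    (Q F : Set E) : Prop :=
  IsExposed ℝ Q F ∧ F.Nonempty ∧ dim F + 1 = dim Q

/-- The polytope `Q ⊆ ℝ^e` is an extension of `P`: `P` is the image of `Q` under a linear map. -/
def IsExtension {E : Type*} [AddCommGroup E] [Module ℝ E] {e : ℕ}
    (Q : Set (Fin e → ℝ)) (P : Set E) : Prop :=
  IsPolytope Q ∧ ∃ π : (Fin e → ℝ) →ₗ[ℝ] E, π '' Q = P

/-- The extension complexity of a polytope `P`: the minimum number of facets of an extension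
of `P`. -/
noncomputable def xc {E : Type*} [AddCommGroup E] [Module ℝ E] (P : Set E) : ℕ :=
  sInf {k : ℕ | ∃ (e : ℕ) (Q : Set (Fin e → ℝ)),
    IsExtension Q P ∧ {F : Set (Fin e → ℝ) | IsFacet Q F}.encard = k}

open Classical in
/-- The cut vector `δ_G(S) ∈ ℝ^E`: its `uv`-coordinate is `1` if exactly one of `u`, `v` lies
in `S`, and `0` otherwise. -/
noncomputable def cutVector {V : Type*} (G : SimpleGraph V) (S : Set V) : G.edgeSet → ℝ :=
  fun e => if ∃ u v, u ∈ S ∧ v ∉ S ∧ (e : Sym2 V) = s(u, v) then 1 else 0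

/-- The cut polytope of `G`, in `ℝ^E`. -/
def cutPolytope {V : Type*} (G : SimpleGraph V) : Set (G.edgeSet → ℝ) :=
  convexHull ℝ (Set.range (cutVector G))

/-- `H` is obtained, up to relabeling, from `G` by contracting edges: `φ` sends a vertex of `G`
to the vertex of `H` into which it is merged. The vertices merged into `w` form a connected
(nonempty) subgraph, and two distinct vertices of `H` are adjacent exactly if some edge of `G`
joins the corresponding classes. -/
def IsContraction {W V : Type*} (H : SimpleGraph W) (G : SimpleGraph V) : Prop :=
  ∃ φ : V → W, (∀ w, (G.induce (φ ⁻¹' {w})).Connected) ∧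
    ∀ a b, H.Adj a b ↔ a ≠ b ∧ ∃ x y, φ x = a ∧ φ y = b ∧ G.Adj x y

/-- `H` is a minor of `G`: up to relabeling it is obtained by contracting edges in a subgraph
of `G`, that is, by deleting edges and isolated vertices and contracting edges. -/
def IsMinor {W V : Type*} (H : SimpleGraph W) (G : SimpleGraph V) : Prop :=
  ∃ G' : G.Subgraph, IsContraction H G'.coe

/-- The complete tripartite graph `K_{1,n,n}`. -/
abbrev K1nn (n : ℕ) : SimpleGraph (Σ i : Fin 3, Fin (![1, n, n] i)) :=
  SimpleGraph.completeMultipartiteGraph (fun i : Fin 3 => Fin (![1, n, n] i))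

end CutExtension

namespace CutExtension

/-! Suppose `G` has a $K_{m+1}$ minor. For $a,b\subseteq\{1,\dots,m\}$ there are inequalities
$g_a\le 1$ valid on the cut polytope and cuts $x_b$ whose slacks are $(1-|a\cap b|)^2$: positive on
disjoint pairs, zero when $|a\cap b|=1$. In an extension $Q$, let $\Phi_a$ be the face where $g_a$
is tight and $q_b$ a lift of $x_b$. A facet $F$ of $Q$ gives the rectangle of pairs with
$\Phi_a\subseteq F$ and $q_b\notin F$. It contains no pair with $|a\cap b|=1$, since then
$q_b\in\Phi_a$. For disjoint $a,b$ with $a\ne\emptyset$, some facet separates $q_b$ from $\Phi_a$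
(`IsPolytope.exists_isFacet`), so the rectangles cover these pairs. There are $3^m$ disjoint pairs,
and each rectangle holds at most $2^m$ of them (`sum_disjoint_rectangle_le`). One more rectangle
serves $a=\emptyset$, so $\mathrm{xc}+1\ge(3/2)^m$. The tripartite case follows because $K_{n+1}$ is
a minor of $K_{1,n,n}$. -/

/-! ### Rectangle covers of the disjointness relation -/

open Finset in
open Classical in
theorem sum_disjoint_powerset {α : Type*} (s : Finset α) :
    ∑ a ∈ s.powerset, ∑ b ∈ s.powerset, (if Disjoint a b then 1 else 0) = 3 ^ #s := by
  induction s using Finset.induction_on with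
  | empty => simp
  | insert x s hx ih =>
    have key : ∀ a ∈ s.powerset, ∀ b ∈ s.powerset,
        (if Disjoint a b then 1 else 0) + (if Disjoint a (insert x b) then 1 else 0)
          + ((if Disjoint (insert x a) b then 1 else 0)
          + (if Disjoint (insert x a) (insert x b) then 1 else 0))
          = 3 * (if Disjoint a b then 1 else 0) := by
      intro a ha b hb
      have ha' : x ∉ a := fun h => hx (mem_powerset.1 ha h)
      have hb' : x ∉ b := fun h => hx (mem_powerset.1 hb h)
      simp only [disjoint_insert_left, disjoint_insert_right, ha', hb', mem_insert, true_or,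
        not_true_eq_false, false_and, not_false_eq_true, true_and, if_false]
      split_ifs <;> rfl
    rw [sum_powerset_insert hx]
    simp only [sum_powerset_insert hx, ← sum_add_distrib]
    rw [card_insert_of_notMem hx, pow_succ', ← ih, mul_sum]
    refine sum_congr rfl fun a ha => ?_
    rw [mul_sum]
    exact sum_congr rfl fun b hb => key a ha b hb

open Finset in
open Classical in
/-- A combinatorial rectangle without pairs of sets meeting in exactly one element contains few
disjoint pairs. -/
theorem sum_disjoint_rectangle_le {α : Type*} (s : Finset α) :
    ∀ A B : Finset α → Prop,
      (∀ a b, a ⊆ s → b ⊆ s → A a → B b → #(a ∩ b) ≠ 1) →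
      ∑ a ∈ s.powerset, ∑ b ∈ s.powerset, (if Disjoint a b ∧ A a ∧ B b then 1 else 0)
        ≤ 2 ^ #s := by
  induction s using Finset.induction_on with
  | empty =>
    intro A B _
    simp only [powerset_empty, sum_singleton, card_empty, pow_zero]
    split_ifs <;> simp
  | insert x s hx ih =>
    intro A B hAB
    -- The rectangle is projected to `s` in two ways, forgetting `x` on one side only, so no
    -- intersection changes size. Over a disjoint pair `(a, b)` at most three pairs are disjoint. By
    -- `hno` they do not all lie in the rectangle, and the two projections account for those that
    -- do.
    have h1 := ih (fun a => A a ∨ A (insert x a)) B (by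
      intro a b ha hb hA hB
      have hb' : x ∉ b := fun h => hx (hb h)
      rcases hA with hA | hA
      · exact hAB a b (ha.trans (subset_insert _ _)) (hb.trans (subset_insert _ _)) hA hB
      · have := hAB _ b (insert_subset_insert x ha) (hb.trans (subset_insert _ _)) hA hB
        rwa [insert_inter_of_notMem hb'] at this)
    have h2 := ih A (fun b => B b ∨ B (insert x b)) (by
      intro a b ha hb hA hB
      have ha' : x ∉ a := fun h => hx (ha h)
      rcases hB with hB | hB
      · exact hAB a b (ha.trans (subset_insert _ _)) (hb.trans (subset_insert _ _)) hA hB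
      · have := hAB a _ (ha.trans (subset_insert _ _)) (insert_subset_insert x hb) hA hB
        rwa [inter_insert_of_notMem ha'] at this)
    have key : ∀ a ∈ s.powerset, ∀ b ∈ s.powerset,
        (if Disjoint a b ∧ A a ∧ B b then 1 else 0)
          + (if Disjoint a (insert x b) ∧ A a ∧ B (insert x b) then 1 else 0)
          + ((if Disjoint (insert x a) b ∧ A (insert x a) ∧ B b then 1 else 0)
          + (if Disjoint (insert x a) (insert x b) ∧ A (insert x a) ∧ B (insert x b)
              then 1 else 0))
          ≤ (if Disjoint a b ∧ (A a ∨ A (insert x a)) ∧ B b then 1 else 0)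
          + (if Disjoint a b ∧ A a ∧ (B b ∨ B (insert x b)) then 1 else 0) := by
      intro a ha b hb
      rw [mem_powerset] at ha hb
      have ha' : x ∉ a := fun h => hx (ha h)
      have hb' : x ∉ b := fun h => hx (hb h)
      have hno : Disjoint a b → A (insert x a) → B (insert x b) → False := by
        intro hd hA hB
        apply hAB _ _ (insert_subset_insert x ha) (insert_subset_insert x hb) hA hB
        rw [← insert_inter_distrib, disjoint_iff_inter_eq_empty.1 hd]
        simp
      simp only [disjoint_insert_left, disjoint_insert_right, ha', hb', mem_insert, true_or,
        not_true_eq_false, false_and, not_false_eq_true, true_and, if_false]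
      by_cases hd : Disjoint a b
      · have := hno hd
        simp only [hd, true_and]
        generalize A a = p₁ at *
        generalize A (insert x a) = p₂ at *
        generalize B b = p₃ at *
        generalize B (insert x b) = p₄ at *
        clear hAB h1 h2
        by_cases p₁ <;> by_cases p₂ <;> by_cases p₃ <;> by_cases p₄ <;> simp_all
      · simp [hd]
    rw [sum_powerset_insert hx]
    simp only [sum_powerset_insert hx, ← sum_add_distrib]
    rw [card_insert_of_notMem hx, pow_succ', two_mul]
    refine le_trans (sum_le_sum fun a ha => sum_le_sum fun b hb => key a ha b hb) ?_
    simp only [sum_add_distrib]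
    convert add_le_add h1 h2

open Finset in
open Classical in
/-- Covering all disjoint pairs of subsets of an `m`-set by rectangles without pairs of sets that
meet in exactly one element takes at least `(3/2)^m` rectangles. -/
theorem three_pow_le_of_rectangle_cover {α ι : Type*} [Fintype α] (I : Finset ι)
    (A B : ι → Finset α → Prop)
    (hAB : ∀ i ∈ I, ∀ a b, A i a → B i b → #(a ∩ b) ≠ 1)
    (hcover : ∀ a b : Finset α, Disjoint a b → ∃ i ∈ I, A i a ∧ B i b) :
    3 ^ Fintype.card α ≤ #I * 2 ^ Fintype.card α := by
  calc 3 ^ Fintype.card α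
      = ∑ a ∈ (univ : Finset α).powerset, ∑ b ∈ (univ : Finset α).powerset,
          (if Disjoint a b then 1 else 0) := (sum_disjoint_powerset univ).symm
    _ ≤ ∑ a ∈ (univ : Finset α).powerset, ∑ b ∈ (univ : Finset α).powerset,
          ∑ i ∈ I, (if Disjoint a b ∧ A i a ∧ B i b then 1 else 0) := by
        refine sum_le_sum fun a _ => sum_le_sum fun b _ => ?_
        split_ifs with hd
        · obtain ⟨i, hi, h⟩ := hcover a b hd
          refine le_trans ?_ (single_le_sum (fun _ _ => Nat.zero_le _) hi)
          rw [if_pos ⟨hd, h⟩]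
        · exact Nat.zero_le _
    _ = ∑ i ∈ I, ∑ a ∈ (univ : Finset α).powerset, ∑ b ∈ (univ : Finset α).powerset,
          (if Disjoint a b ∧ A i a ∧ B i b then 1 else 0) := by
        rw [sum_comm (s := I)]
        refine sum_congr rfl fun a _ => ?_
        rw [sum_comm]
    _ ≤ ∑ _i ∈ I, 2 ^ Fintype.card α :=
        sum_le_sum fun i hi => sum_disjoint_rectangle_le univ (A i) (B i)
          fun a b _ _ => hAB i hi a b
    _ = #I * 2 ^ Fintype.card α := by rw [sum_const, smul_eq_mul]

/-! ### Faces and facets of polytopes -/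

section Polytope

variable {E : Type*} [NormedAddCommGroup E] [NormedSpace ℝ E]

/-- By Krein–Milman an exposed face is determined by its extreme points, which lie in the finite
generating set. -/
theorem IsPolytope.finite_isExposed {Q : Set E} (hQ : IsPolytope Q) :
    {F : Set E | IsExposed ℝ Q F}.Finite := by
  obtain ⟨s, hs, rfl⟩ := hQ
  have hcomp : IsCompact (convexHull ℝ s) := hs.isCompact_convexHull (𝕜 := ℝ)
  refine Set.Finite.of_finite_image (f := fun F => F.extremePoints ℝ)
    (hs.finite_subsets.subset ?_) ?_
  · rintro _ ⟨F, hF, rfl⟩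
    exact hF.isExtreme.extremePoints_subset_extremePoints.trans
      extremePoints_convexHull_subset
  · intro F hF G hG h
    rw [← closure_convexHull_extremePoints (hF.isCompact hcomp)
        (hF.convex (convex_convexHull ℝ s)),
      ← closure_convexHull_extremePoints (hG.isCompact hcomp)
        (hG.convex (convex_convexHull ℝ s))]
    exact congrArg (fun t => closure (convexHull ℝ t)) h

theorem IsPolytope.finite_isFacet {Q : Set E} (hQ : IsPolytope Q) :
    {F : Set E | IsFacet Q F}.Finite :=
  hQ.finite_isExposed.subset fun _ hF => hF.1

theorem isExposed_setOf_eq [FiniteDimensional ℝ E] {Q : Set E} (l : E →ₗ[ℝ] ℝ) {β : ℝ}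
    (hl : ∀ x ∈ Q, l x ≤ β) : IsExposed ℝ Q {x ∈ Q | l x = β} := by
  rintro ⟨p, hp, hpβ⟩
  refine ⟨LinearMap.toContinuousLinearMap l, ?_⟩
  ext x
  simp only [Set.mem_ofPred_eq, LinearMap.coe_toContinuousLinearMap']
  refine and_congr_right fun hx => ⟨fun h y hy => h ▸ hl y hy, fun h => ?_⟩
  exact le_antisymm (hl x hx) (hpβ ▸ h p hp)

/-- Every point of a polytope outside a given nonempty exposed face is separated from that face by
a facet. -/
theorem IsPolytope.exists_isFacet [FiniteDimensional ℝ E] {Q Φ : Set E} (hQ : IsPolytope Q)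
    (hΦ : IsExposed ℝ Q Φ) (hne : Φ.Nonempty) {q : E} (hq : q ∈ Q) (hqΦ : q ∉ Φ) :
    ∃ F, IsFacet Q F ∧ Φ ⊆ F ∧ q ∉ F := by
  have hfin : {F : Set E | IsExposed ℝ Q F ∧ Φ ⊆ F ∧ q ∉ F}.Finite :=
    hQ.finite_isExposed.subset fun _ hF => hF.1
  -- A maximal exposed face that contains `Φ` and misses `q` is shown to be a facet: the directions
  -- of `F` together with `q - p` span those of `Q`.
  obtain ⟨F, hΦF, hmax⟩ := hfin.exists_le_maximal (a := Φ) ⟨hΦ, subset_rfl, hqΦ⟩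
  obtain ⟨hF, -, hqF⟩ := hmax.prop
  refine ⟨F, ⟨hF, hne.mono hΦF, ?_⟩, hΦF, hqF⟩
  obtain ⟨p, hpΦ⟩ := hne
  have hp : p ∈ F := hΦF hpΦ
  have hFQ : F ⊆ Q := hF.subset
  obtain ⟨l, hl⟩ := hF ⟨p, hp⟩
  have hle : ∀ x ∈ Q, l x ≤ l p := (hl ▸ hp).2
  have heq : ∀ x ∈ F, l x = l p := fun x hx => le_antisymm (hle x (hFQ hx)) ((hl ▸ hx).2 p (hFQ hp))
  have hlt : ∀ x ∈ Q, x ∉ F → l x < l p := by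
    intro x hx hxF
    refine lt_of_le_of_ne (hle x hx) fun h => hxF ?_
    rw [hl]
    exact ⟨hx, fun y hy => h ▸ hle y hy⟩
  have hker : ∀ (m : E →ₗ[ℝ] ℝ), vectorSpan ℝ F ≤ LinearMap.ker m ↔ ∀ x ∈ F, m x = m p := by
    intro m
    constructor
    · intro h x hx
      have := h (vsub_mem_vectorSpan ℝ hx hp)
      rwa [vsub_eq_sub, LinearMap.mem_ker, map_sub, sub_eq_zero] at this
    · intro h
      rw [vectorSpan_def, Submodule.span_le]
      rintro _ ⟨x, hx, y, hy, rfl⟩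
      simp [h x hx, h y hy]
  have hlq := hlt q hq hqF
  have hqnot : q - p ∉ vectorSpan ℝ F := by
    intro h
    have := (hker l.toLinearMap).2 heq h
    rw [LinearMap.mem_ker, map_sub, sub_eq_zero] at this
    exact hlq.ne this
  unfold dim
  apply le_antisymm
  · apply Submodule.finrank_lt_finrank_of_lt
    refine lt_of_le_of_ne (vectorSpan_mono ℝ hFQ) fun h => hqnot ?_
    rw [h]
    exact vsub_mem_vectorSpan ℝ hq (hFQ hp)
  set W := vectorSpan ℝ F ⊔ Submodule.span ℝ {q - p} with hW
  have hWrank : Module.finrank ℝ W ≤ Module.finrank ℝ (vectorSpan ℝ F) + 1 :=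
    (Submodule.finrank_add_le_finrank_add_finrank _ _).trans
      (Nat.add_le_add_left (finrank_span_singleton (sub_ne_zero.2 (by rintro rfl; exact hqF hp))).le _)
  refine le_trans (Submodule.finrank_mono ?_) hWrank
  obtain ⟨s, hs, hQs⟩ := hQ
  have hsQ : s ⊆ Q := hQs ▸ subset_convexHull ℝ s
  suffices hsub : ∀ v ∈ s, v - p ∈ W by
    have hQW : ∀ x ∈ Q, x - p ∈ W := by
      intro x hx
      rw [hQs] at hx
      refine convexHull_min (t := {x | x - p ∈ W}) hsub ?_ hx
      intro x hx y hy a b _ _ hab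
      have : a • x + b • y - p = a • (x - p) + b • (y - p) := by
        rw [smul_sub, smul_sub, sub_add_sub_comm, ← add_smul, hab, one_smul]
      rw [Set.mem_ofPred_eq, this]
      exact W.add_mem (W.smul_mem _ hx) (W.smul_mem _ hy)
    rw [vectorSpan_def, Submodule.span_le]
    rintro _ ⟨x, hx, y, hy, rfl⟩
    have := W.sub_mem (hQW x hx) (hQW y hy)
    simpa using this
  by_contra! hcon
  obtain ⟨v, hv, hvW⟩ := hcon
  -- a functional constant on `F ∪ {q}`, larger at a vertex
  obtain ⟨m, hmq, hmF, hmv⟩ : ∃ m : E →ₗ[ℝ] ℝ, m q = m p ∧ (∀ x ∈ F, m x = m p) ∧ m p < m v := by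
    obtain ⟨m, hm, hWm⟩ := Submodule.exists_le_ker_of_notMem hvW
    have h1 : m q = m p := by
      have : q - p ∈ LinearMap.ker m :=
        hWm (Submodule.mem_sup_right (Submodule.mem_span_singleton_self _))
      rwa [LinearMap.mem_ker, map_sub, sub_eq_zero] at this
    have h2 : ∀ x ∈ F, m x = m p := (hker m).1 (le_sup_left.trans hWm)
    rw [map_sub, sub_ne_zero] at hm
    rcases hm.lt_or_gt with h | h
    · exact ⟨-m, by simp [h1], fun x hx => by simp [h2 x hx], by simpa using h⟩
    · exact ⟨m, h1, h2, h⟩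
  -- Tilt `l` to `l + t • m` until the first generator `w` off `F` becomes maximal. The new face
  -- contains `F` and `w` but still misses `q`, because `m q = m p`; this contradicts maximality.
  obtain ⟨w, ⟨hws, hwm⟩, hwmin⟩ := Set.exists_min_image {w ∈ s | m p < m w}
    (fun w => (l p - l w) / (m w - m p)) (hs.subset (Set.sep_subset _ _)) ⟨v, hv, hmv⟩
  have hwF : w ∉ F := fun h => hwm.ne (hmF w h).symm
  have hlw := hlt w (hsQ hws) hwF
  set t := (l p - l w) / (m w - m p) with ht
  have ht0 : 0 < t := div_pos (sub_pos.2 hlw) (sub_pos.2 hwm)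
  set l' : E →ₗ[ℝ] ℝ := l.toLinearMap + t • m with hl'
  have hl'x : ∀ x, l' x = l x + t * m x := fun x => rfl
  have hle' : ∀ x ∈ Q, l' x ≤ l' p := by
    intro x hx
    rw [hQs] at hx
    refine convexHull_min (t := {x | l' x ≤ l' p}) ?_ (convex_halfSpace_le l'.isLinear _) hx
    intro x hx
    rw [Set.mem_ofPred_eq, hl'x, hl'x]
    rcases le_or_gt (m x) (m p) with h | h
    · have := hle x (hsQ hx)
      nlinarith
    · have := hwmin x ⟨hx, h⟩
      rw [le_div_iff₀ (sub_pos.2 h)] at this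
      linarith
  have hw' : l' w = l' p := by
    have : t * (m w - m p) = l p - l w := div_mul_cancel₀ _ (sub_pos.2 hwm).ne'
    rw [hl'x, hl'x]
    linarith
  have hsubset : F ⊆ {x ∈ Q | l' x = l' p} :=
    fun x hx => ⟨hFQ hx, by rw [hl'x, hl'x, heq x hx, hmF x hx]⟩
  refine hwF (hmax.le_of_ge (y := {x ∈ Q | l' x = l' p})
    ⟨isExposed_setOf_eq l' hle', hΦF.trans hsubset, ?_⟩ hsubset ⟨hsQ hws, hw'⟩)
  rintro ⟨-, h⟩
  rw [hl'x, hl'x, hmq] at h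
  linarith

end Polytope

/-! ### From slacks to extension complexity -/

/-- Ensures that the `sInf` in `xc` is attained rather than the default value `0`; `P` extends
itself. -/
theorem exists_isExtension_encard {ι : Type*} [Finite ι] {P : Set (ι → ℝ)} (hP : IsPolytope P) :
    {k : ℕ | ∃ (e : ℕ) (Q : Set (Fin e → ℝ)),
      IsExtension Q P ∧ {F : Set (Fin e → ℝ) | IsFacet Q F}.encard = k}.Nonempty := by
  obtain ⟨e, ⟨f⟩⟩ := Finite.exists_equiv_fin ι
  obtain ⟨s, hs, rfl⟩ := hP
  set L : (ι → ℝ) ≃ₗ[ℝ] (Fin e → ℝ) := LinearEquiv.funCongrLeft ℝ ℝ f.symm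
  have hpoly : IsPolytope (L '' convexHull ℝ s) :=
    ⟨L '' s, hs.image _, L.toLinearMap.image_convexHull s⟩
  refine ⟨_, e, _, ⟨hpoly, L.symm.toLinearMap, ?_⟩, hpoly.finite_isFacet.encard_eq_coe⟩
  rw [Set.image_image]
  simp

/-- If the slacks of the points `x b` with respect to the inequalities `g a ≤ 1` are positive on
disjoint pairs and vanish on pairs of sets meeting in one element, the extension complexity is
exponential. -/
theorem three_pow_le_xc {ι α : Type*} [Finite ι] [Fintype α] [DecidableEq α] {P : Set (ι → ℝ)}
    (hP : IsPolytope P) (g : Finset α → (ι → ℝ) →ₗ[ℝ] ℝ) (x : Finset α → ι → ℝ)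
    (hx : ∀ b, x b ∈ P) (hg : ∀ a, ∀ y ∈ P, g a y ≤ 1)
    (hgx : ∀ a b, g a (x b) = 1 - (1 - ((a ∩ b).card : ℝ)) ^ 2) :
    3 ^ Fintype.card α ≤ (xc P + 1) * 2 ^ Fintype.card α := by
  classical
  obtain ⟨e, Q, ⟨hQ, π, hπ⟩, hcard⟩ := Nat.sInf_mem (exists_isExtension_encard hP)
  change _ = ((xc P : ℕ) : ℕ∞) at hcard
  have hfin := hQ.finite_isFacet
  have hlift : ∀ b, ∃ y ∈ Q, π y = x b := fun b => by
    have := hx b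
    rwa [← hπ] at this
  choose q hqQ hq using hlift
  set Φ : Finset α → Set (Fin e → ℝ) := fun a => {y ∈ Q | (g a ∘ₗ π) y = 1} with hΦ
  have hle : ∀ a, ∀ y ∈ Q, (g a ∘ₗ π) y ≤ 1 := fun a y hy =>
    hg a _ (hπ ▸ Set.mem_image_of_mem π hy)
  have hmem : ∀ a b, q b ∈ Φ a ↔ (a ∩ b).card = 1 := by
    intro a b
    simp only [hΦ, Set.mem_ofPred_eq, hqQ, true_and, LinearMap.comp_apply, hq, hgx]
    rw [sub_eq_self, sq_eq_zero_iff, sub_eq_zero, eq_comm, Nat.cast_eq_one]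
  have hfacets : hfin.toFinset.card = xc P := by
    rw [hfin.encard_eq_coe_toFinset_card] at hcard
    exact_mod_cast hcard
  -- The index `none` covers `a = ∅`, where `Φ a` may be empty and no facet need be available. For
  -- `i ∈ a` the point `q {i}` lies in `Φ a`.
  have key := three_pow_le_of_rectangle_cover (α := α) (Finset.insertNone hfin.toFinset)
    (fun o a => o.elim (a = ∅) fun F => Φ a ⊆ F) (fun o b => o.elim True fun F => q b ∉ F) ?_ ?_
  · rwa [Finset.card_insertNone, hfacets] at key
  · rintro (_ | F) _ a b hA hB
    · simp only [Option.elim] at hA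
      simp [hA]
    · intro h
      exact hB (hA (by rw [hmem]; convert h))
  · intro a b hd
    rcases a.eq_empty_or_nonempty with rfl | ⟨i, hi⟩
    · exact ⟨none, by simp, rfl, trivial⟩
    · obtain ⟨F, hF, hΦF, hqF⟩ := hQ.exists_isFacet (isExposed_setOf_eq _ (hle a))
        ⟨q {i}, (hmem a {i}).2 (by simp [Finset.inter_singleton_of_mem hi])⟩ (hqQ b)
        (fun h => by
          have := (hmem a b).1 h
          rw [Finset.disjoint_iff_inter_eq_empty.1 hd] at this
          simp at this)
      exact ⟨some F, by simpa using hF, hΦF, hqF⟩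

/-! ### Cut vectors and contractions -/

theorem isPolytope_cutPolytope {V : Type*} [Finite V] (G : SimpleGraph V) :
    IsPolytope (cutPolytope G) :=
  ⟨_, Set.finite_range _, rfl⟩

open Classical in
theorem cutVector_apply {V : Type*} (G : SimpleGraph V) (S : Set V) {x y : V}
    (h : s(x, y) ∈ G.edgeSet) :
    cutVector G S ⟨s(x, y), h⟩ = if (x ∈ S ↔ y ∈ S) then 0 else 1 := by
  have : (∃ u v, u ∈ S ∧ v ∉ S ∧ s(x, y) = s(u, v)) ↔ ¬ (x ∈ S ↔ y ∈ S) := by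
    constructor
    · rintro ⟨u, v, hu, hv, he⟩ hiff
      rcases Sym2.eq_iff.1 he with ⟨rfl, rfl⟩ | ⟨rfl, rfl⟩ <;> tauto
    · intro hne
      by_cases hx : x ∈ S
      · exact ⟨x, y, hx, by tauto, rfl⟩
      · exact ⟨y, x, by tauto, hx, Sym2.eq_swap⟩
  simp only [cutVector, this]
  split_ifs <;> rfl

theorem cutVector_nonneg {V : Type*} (G : SimpleGraph V) (S : Set V) (e : G.edgeSet) :
    0 ≤ cutVector G S e := by
  unfold cutVector
  split_ifs <;> simp

theorem cutVector_le_one {V : Type*} (G : SimpleGraph V) (S : Set V) (e : G.edgeSet) :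
    cutVector G S e ≤ 1 := by
  unfold cutVector
  split_ifs <;> simp

section Contraction

variable {V : Type*} {G : SimpleGraph V} {G' : G.Subgraph} {N : ℕ} {φ : G'.verts → Fin N}

open Classical in
/-- A coordinate of the cut polytope for each pair of classes of a contraction to a complete
graph. -/
theorem exists_pair_functional
    (hadj : ∀ a b, (SimpleGraph.completeGraph (Fin N)).Adj a b ↔
      a ≠ b ∧ ∃ x y, φ x = a ∧ φ y = b ∧ G'.coe.Adj x y) :
    ∃ Y : Fin N → Fin N → (G.edgeSet → ℝ) →ₗ[ℝ] ℝ,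
      (∀ i j S, 0 ≤ Y i j (cutVector G S) ∧ Y i j (cutVector G S) ≤ 1) ∧
      ∀ (S : Set V) (c : Fin N → Prop), (∀ v : G'.verts, (v : V) ∈ S ↔ c (φ v)) →
        ∀ i j, Y i j (cutVector G S) = if (c i ↔ c j) then 0 else 1 := by
  have hpair : ∀ i j, ∃ Y : (G.edgeSet → ℝ) →ₗ[ℝ] ℝ,
      (∀ S, 0 ≤ Y (cutVector G S) ∧ Y (cutVector G S) ≤ 1) ∧
      ∀ (S : Set V) (c : Fin N → Prop), (∀ v : G'.verts, (v : V) ∈ S ↔ c (φ v)) →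
        Y (cutVector G S) = if (c i ↔ c j) then 0 else 1 := by
    intro i j
    by_cases hij : i = j
    · subst hij
      exact ⟨0, by simp, by simp⟩
    · obtain ⟨-, x, y, rfl, rfl, hxy⟩ := (hadj i j).1 hij
      have hG : s((x : V), (y : V)) ∈ G.edgeSet := G'.adj_sub hxy
      refine ⟨LinearMap.proj ⟨_, hG⟩,
        fun S => ⟨cutVector_nonneg _ _ _, cutVector_le_one _ _ _⟩, fun S c hc => ?_⟩
      rw [LinearMap.proj_apply, cutVector_apply]
      simp only [hc]
  choose Y hY hY' using hpair
  exact ⟨Y, hY, fun S c hc i j => hY' i j S c hc⟩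

/-- A functional vanishing on the cuts that respect the classes of a contraction, and at least `1`
on all other cuts. -/
theorem exists_penalty_functional [Finite V]
    (hconn : ∀ w, (G'.coe.induce (φ ⁻¹' {w})).Connected) :
    ∃ R : (G.edgeSet → ℝ) →ₗ[ℝ] ℝ,
      (∀ (S : Set V) (c : Fin N → Prop), (∀ v : G'.verts, (v : V) ∈ S ↔ c (φ v)) →
        R (cutVector G S) = 0) ∧
      ∀ S : Set V, (∃ c : Fin N → Prop, ∀ v : G'.verts, (v : V) ∈ S ↔ c (φ v)) ∨
        1 ≤ R (cutVector G S) := by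
  classical
  have := Fintype.ofFinite G.edgeSet
  -- Edges inside a class. A cut crossing none of them is constant on each class by connectedness;
  -- any other cut pays at least `1`.
  set I : Finset G.edgeSet :=
    {e | ∃ x y : G'.verts, G'.coe.Adj x y ∧ φ x = φ y ∧ (e : Sym2 V) = s((x : V), (y : V))}
    with hI
  have hR : ∀ z, (∑ e ∈ I, LinearMap.proj e : (G.edgeSet → ℝ) →ₗ[ℝ] ℝ) z = ∑ e ∈ I, z e := by
    simp [LinearMap.sum_apply]
  refine ⟨∑ e ∈ I, LinearMap.proj e, fun S c hc => ?_, fun S => ?_⟩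
  · rw [hR]
    refine Finset.sum_eq_zero fun e he => ?_
    obtain ⟨x, y, hxy, hφ, he⟩ := (Finset.mem_filter.1 he).2
    obtain ⟨e, heG⟩ := e
    obtain rfl : e = s((x : V), (y : V)) := he
    rw [cutVector_apply, if_pos]
    rw [hc, hc, hφ]
  · by_cases hS : ∀ x y : G'.verts, G'.coe.Adj x y → φ x = φ y → ((x : V) ∈ S ↔ (y : V) ∈ S)
    · refine Or.inl ⟨fun i => ∃ v, φ v = i ∧ (v : V) ∈ S, fun v => ⟨fun h => ⟨v, rfl, h⟩, ?_⟩⟩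
      rintro ⟨u, hu, huS⟩
      have hreach := (hconn (φ v)).preconnected ⟨u, hu⟩ ⟨v, rfl⟩
      obtain ⟨p⟩ := hreach
      have hwalk : ∀ {a b : ↥(φ ⁻¹' {φ v})}, (G'.coe.induce (φ ⁻¹' {φ v})).Walk a b →
          (((a : G'.verts) : V) ∈ S ↔ ((b : G'.verts) : V) ∈ S) := by
        intro a b p
        induction p with
        | nil => rfl
        | @cons a b c hab _ ih =>
          exact (hS a b hab ((a.2 : φ a = φ v).trans (b.2 : φ b = φ v).symm)).trans ih
      exact (hwalk p).1 huS
    · right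
      push Not at hS
      obtain ⟨x, y, hxy, hφ, hne⟩ := hS
      have hG : s((x : V), (y : V)) ∈ G.edgeSet := G'.adj_sub hxy
      rw [hR]
      refine le_trans ?_ (Finset.single_le_sum (f := cutVector G S) (a := ⟨_, hG⟩)
        (fun e _ => cutVector_nonneg G S e)
        (Finset.mem_filter.2 ⟨Finset.mem_univ _, x, y, hxy, hφ, rfl⟩))
      rw [cutVector_apply, if_neg (by tauto)]

end Contraction

/-! ### Slacks of the cut polytope -/

open Finset in
/-- The cut polytope of a graph with a `K_{m+1}` minor has the unique disjointness matrix as a part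
of a slack matrix. -/
theorem exists_unique_disjointness_slacks {V : Type*} [Finite V] {G : SimpleGraph V} {m : ℕ}
    (h : IsMinor (SimpleGraph.completeGraph (Fin (m + 1))) G) :
    ∃ (g : Finset (Fin m) → (G.edgeSet → ℝ) →ₗ[ℝ] ℝ) (T : Finset (Fin m) → Set V),
      (∀ a S, g a (cutVector G S) ≤ 1) ∧
      ∀ a b, g a (cutVector G (T b)) = 1 - (1 - (#(a ∩ b) : ℝ)) ^ 2 := by
  classical
  obtain ⟨G', φ, hconn, hadj⟩ := h
  obtain ⟨Y, hY, hYc⟩ := exists_pair_functional hadj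
  obtain ⟨R, hRc, hR⟩ := exists_penalty_functional hconn
  -- On cuts respecting the classes, let $y_i\in\{0,1\}$ say whether class $i$ is separated from
  -- class $0$. Then $2y_iy_j=y_i+y_j-y_{ij}$, which makes $1-(1-\sum_{i\in a} y_i)^2$ linear in the
  -- cut coordinates. On other cuts the first two terms are at most $2m+m^2/2$, so the penalty
  -- brings the value to at most $0$.
  set g : Finset (Fin m) → (G.edgeSet → ℝ) →ₗ[ℝ] ℝ := fun a =>
    (2 : ℝ) • ∑ i ∈ a, Y 0 i.succ
      - (2⁻¹ : ℝ) • ∑ i ∈ a, ∑ j ∈ a, (Y 0 i.succ + Y 0 j.succ - Y i.succ j.succ)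
      - (2 * (m : ℝ) + (m : ℝ) ^ 2) • R with hg
  have hga : ∀ a z, g a z = 2 * ∑ i ∈ a, Y 0 i.succ z
      - 2⁻¹ * ∑ i ∈ a, ∑ j ∈ a, (Y 0 i.succ z + Y 0 j.succ z - Y i.succ j.succ z)
      - (2 * (m : ℝ) + (m : ℝ) ^ 2) * R z := by
    intro a z
    simp [hg, LinearMap.sum_apply]
  have hgc : ∀ a (S : Set V) (c : Fin (m + 1) → Prop),
      (∀ v : G'.verts, (v : V) ∈ S ↔ c (φ v)) →
      g a (cutVector G S) = 1 - (1 - ∑ i ∈ a, if (c 0 ↔ c i.succ) then (0 : ℝ) else 1) ^ 2 := by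
    intro a S c hc
    rw [hga, hRc S c hc]
    simp only [hYc S c hc]
    have hprod : ∑ i ∈ a, ∑ j ∈ a, ((if (c 0 ↔ c i.succ) then (0 : ℝ) else 1)
        + (if (c 0 ↔ c j.succ) then 0 else 1) - (if (c i.succ ↔ c j.succ) then 0 else 1))
        = 2 * ((∑ i ∈ a, if (c 0 ↔ c i.succ) then (0 : ℝ) else 1)
          * ∑ i ∈ a, if (c 0 ↔ c i.succ) then (0 : ℝ) else 1) := by
      rw [sum_mul_sum, mul_sum]
      refine sum_congr rfl fun i _ => ?_
      rw [mul_sum]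
      refine sum_congr rfl fun j _ => ?_
      by_cases h0 : c 0 <;> by_cases h1 : c i.succ <;> by_cases h2 : c j.succ <;>
        simp [h0, h1, h2] <;> norm_num
    rw [hprod]
    ring
  refine ⟨g, fun b => {v | ∃ h : v ∈ G'.verts, ∃ i ∈ b, φ ⟨v, h⟩ = i.succ}, fun a S => ?_,
    fun a b => ?_⟩
  · rcases hR S with ⟨c, hc⟩ | hR1
    · rw [hgc a S c hc]
      exact sub_le_self _ (sq_nonneg _)
    · have hcard : (#a : ℝ) ≤ m := by
        have := card_le_univ a
        rw [Fintype.card_fin] at this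
        exact_mod_cast this
      have h1 : ∑ i ∈ a, Y 0 i.succ (cutVector G S) ≤ m := by
        refine (sum_le_card_nsmul _ _ 1 fun i _ => (hY _ _ _).2).trans ?_
        simpa using hcard
      have h2 : -((m : ℝ) * m) ≤ ∑ i ∈ a, ∑ j ∈ a, (Y 0 i.succ (cutVector G S)
          + Y 0 j.succ (cutVector G S) - Y i.succ j.succ (cutVector G S)) := by
        calc -((m : ℝ) * m) ≤ ∑ i ∈ a, ∑ j ∈ a, (-1 : ℝ) := by
              simp only [sum_const, nsmul_eq_mul]
              nlinarith [Nat.cast_nonneg (α := ℝ) #a]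
          _ ≤ _ := sum_le_sum fun i _ => sum_le_sum fun j _ => by
              have := (hY 0 i.succ S).1
              have := (hY 0 j.succ S).1
              have := (hY i.succ j.succ S).2
              linarith
      rw [hga]
      have hm : (0 : ℝ) ≤ m := Nat.cast_nonneg m
      nlinarith [mul_le_mul_of_nonneg_left hR1 (by positivity : 0 ≤ 2 * (m : ℝ) + (m : ℝ) ^ 2)]
  · rw [hgc a _ (fun j => ∃ i ∈ b, j = i.succ) fun v => ?_]
    · congr 3
      simp [(Fin.succ_ne_zero _).symm]
    · simp

/-! ### Exponential bounds and the minor of $K_{1,n,n}$ -/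

theorem three_pow_le_xc_cutPolytope {V : Type*} [Finite V] {G : SimpleGraph V} {m : ℕ}
    (h : IsMinor (SimpleGraph.completeGraph (Fin (m + 1))) G) :
    3 ^ m ≤ (xc (cutPolytope G) + 1) * 2 ^ m := by
  obtain ⟨g, T, hg, hgT⟩ := exists_unique_disjointness_slacks h
  have := three_pow_le_xc (isPolytope_cutPolytope G) g (fun b => cutVector G (T b))
    (fun b => subset_convexHull ℝ _ (Set.mem_range_self _)) (fun a y hy => ?_) hgT
  · simpa using this
  · refine convexHull_min (t := {y | g a y ≤ 1}) ?_ (convex_halfSpace_le (g a).isLinear 1) hy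
    rintro _ ⟨S, rfl⟩
    exact hg a S

/-- Since $\sqrt2\le 3/2$, we get $2\cdot2^{n/4}\le2^{m/2}\le(3/2)^m$ once $(m+1)/4+1\le m/2$, that
is $m\ge5$. The spare factor $2$ absorbs the $+1$ beside `xc`. -/
theorem two_rpow_le_xc_cutPolytope {V : Type*} [Finite V] {G : SimpleGraph V} {n : ℕ}
    (hn : 6 ≤ n) (h : IsMinor (SimpleGraph.completeGraph (Fin n)) G) :
    (2 : ℝ) ^ (1 / 4 * (n : ℝ)) ≤ xc (cutPolytope G) := by
  obtain ⟨m, rfl⟩ : ∃ m, n = m + 1 := ⟨n - 1, by omega⟩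
  have h3 : (3 : ℝ) ^ m ≤ (xc (cutPolytope G) + 1) * 2 ^ m := by
    exact_mod_cast three_pow_le_xc_cutPolytope h
  have hm : (5 : ℝ) ≤ m := by
    have : 5 ≤ m := by omega
    exact_mod_cast this
  have hk : (3 / 2 : ℝ) ^ m ≤ xc (cutPolytope G) + 1 := by
    rw [div_pow, div_le_iff₀ (by positivity)]
    exact h3
  have hsq : (2 : ℝ) ^ (1 / 2 : ℝ) ≤ 3 / 2 := by
    rw [← Real.sqrt_eq_rpow, Real.sqrt_le_left (by norm_num)]
    norm_num
  have h2 : (2 : ℝ) ^ (1 / 4 * ((m + 1 : ℕ) : ℝ)) * 2 ≤ (3 / 2 : ℝ) ^ m := by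
    calc (2 : ℝ) ^ (1 / 4 * ((m + 1 : ℕ) : ℝ)) * 2
        = (2 : ℝ) ^ (1 / 4 * ((m + 1 : ℕ) : ℝ) + 1) := by
          rw [Real.rpow_add_one (by norm_num)]
      _ ≤ (2 : ℝ) ^ (1 / 2 * (m : ℝ)) := by
          refine Real.rpow_le_rpow_of_exponent_le (by norm_num) ?_
          push_cast
          linarith
      _ = ((2 : ℝ) ^ (1 / 2 : ℝ)) ^ m := by
          rw [Real.rpow_mul (by norm_num), Real.rpow_natCast]
      _ ≤ (3 / 2 : ℝ) ^ m := pow_le_pow_left₀ (by positivity) hsq m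
  have h1 : (1 : ℝ) ≤ (2 : ℝ) ^ (1 / 4 * ((m + 1 : ℕ) : ℝ)) :=
    Real.one_le_rpow (by norm_num) (by positivity)
  linarith

/-- Contracting the edges of a perfect matching between the two large classes of `K_{1,n,n}` gives
`K_{n+1}`. -/
theorem isMinor_K1nn (n : ℕ) : IsMinor (SimpleGraph.completeGraph (Fin (n + 1))) (K1nn n) := by
  -- The apex forms class `0`; the `k`-th vertices of the two large parts form class `k.succ`.
  let ψ : (i : Fin 3) → Fin (![1, n, n] i) → Fin (n + 1) :=
    Fin.cons (fun _ => 0) (Fin.cons Fin.succ (Fin.cons Fin.succ fun i => i.elim0))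
  have hsurj : ∀ j : Fin (n + 1), j ≠ 0 → ∀ i : Fin 3, i ≠ 0 → ∃ x, ψ i x = j := by
    intro j hj i hi
    obtain ⟨k, rfl⟩ := Fin.exists_succ_eq.2 hj
    fin_cases i
    · exact absurd rfl hi
    · exact ⟨k, rfl⟩
    · exact ⟨k, rfl⟩
  have hinj : ∀ i : Fin 3, Function.Injective (ψ i) := by
    intro i
    fin_cases i
    · exact fun (x y : Fin 1) _ => Subsingleton.elim x y
    · exact Fin.succ_injective n
    · exact Fin.succ_injective n
  have hzero : ∃ x, ψ 0 x = 0 := ⟨(0 : Fin 1), rfl⟩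
  refine ⟨⊤, fun v => ψ v.1.1 v.1.2, fun w => ?_, fun a b => ?_⟩
  · have hne : ∃ v : (Σ i : Fin 3, Fin (![1, n, n] i)), ψ v.1 v.2 = w := by
      by_cases hw : w = 0
      · exact hzero.elim fun x hx => ⟨⟨0, x⟩, hx.trans hw.symm⟩
      · exact (hsurj w hw 1 (by decide)).elim fun x hx => ⟨⟨1, x⟩, hx⟩
    obtain ⟨v, hv⟩ := hne
    refine @SimpleGraph.Connected.mk _ _ ?_ ⟨⟨⟨v, trivial⟩, hv⟩⟩
    rintro ⟨⟨⟨i, x⟩, hx⟩, hxw⟩ ⟨⟨⟨j, y⟩, hy⟩, hyw⟩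
    by_cases hij : i = j
    · subst hij
      obtain rfl : x = y := hinj i (Eq.trans hxw (Eq.symm hyw))
      exact SimpleGraph.Reachable.refl _
    · exact SimpleGraph.Adj.reachable (show i ≠ j from hij)
  · refine ⟨fun hab => ⟨hab, ?_⟩, fun h => h.1⟩
    have hex : ∃ i j x y, i ≠ j ∧ ψ i x = a ∧ ψ j y = b := by
      by_cases ha : a = 0
      · obtain ⟨x, hx⟩ := hzero
        obtain ⟨y, hy⟩ := hsurj b (fun h => hab (ha.trans h.symm)) 1 (by decide)
        exact ⟨0, 1, x, y, by decide, hx.trans ha.symm, hy⟩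
      · obtain ⟨x, hx⟩ := hsurj a ha 1 (by decide)
        by_cases hb : b = 0
        · obtain ⟨y, hy⟩ := hzero
          exact ⟨1, 0, x, y, by decide, hx, hy.trans hb.symm⟩
        -- Representatives are taken in different large parts, so they are adjacent.
        · obtain ⟨y, hy⟩ := hsurj b hb 2 (by decide)
          exact ⟨1, 2, x, y, by decide, hx, hy⟩
    obtain ⟨i, j, x, y, hij, hx, hy⟩ := hex
    exact ⟨⟨⟨i, x⟩, trivial⟩, ⟨⟨j, y⟩, trivial⟩, hx, hy, hij⟩

end CutExtension

theorem mainTheorem2 :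
    (∃ c : ℝ, 0 < c ∧ ∃ n₀ : ℕ, ∀ n : ℕ, n₀ ≤ n →
      ∀ (V : Type*) [Finite V] (G : SimpleGraph V),
        CutExtension.IsMinor (SimpleGraph.completeGraph (Fin n)) G →
          (2 : ℝ) ^ (c * (n : ℝ)) ≤ (CutExtension.xc (CutExtension.cutPolytope G) : ℝ)) ∧
    (∃ c : ℝ, 0 < c ∧ ∃ n₀ : ℕ, ∀ n : ℕ, n₀ ≤ n →
      (2 : ℝ) ^ (c * (n : ℝ)) ≤
        (CutExtension.xc (CutExtension.cutPolytope (CutExtension.K1nn n)) : ℝ)) := by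
  refine ⟨⟨1 / 4, by norm_num, 6, fun n hn V _ G hG =>
    CutExtension.two_rpow_le_xc_cutPolytope hn hG⟩,
    ⟨1 / 4, by norm_num, 6, fun n hn => ?_⟩⟩
  refine le_trans ?_ (CutExtension.two_rpow_le_xc_cutPolytope (by omega)
    (CutExtension.isMinor_K1nn n))
  refine Real.rpow_le_rpow_of_exponent_le (by norm_num) ?_
  push_cast
  linarith
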